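/- Let $M$ be a Peano continuum, i.e. a compact, connected, locally connected, metrizable (nonempty) space, and suppose that $M$ has no cut points, i.e. $M\setminus\{x\}$ is connected for every $x\in M$. A set $S\subset M$ separates two points $a,b\in M\setminus S$ if $a$ and $b$ lie in different components of $M\setminus S$. A cut pair is a set $\{x,y\}$ of two distinct points of $M$, neither of which is a cut point, such that $M\setminus\{x,y\}$ is disconnected; it is inseparable if $x$ and $y$ are not separated by any other cut pair. Let $\mathcal V_I$ be the set of all inseparable cut pairs of $M$. For $A,B\in\mathcal V_I$ let the interval $(A,B)$ be the set of all $C\in\mathcal V_I$ such that $C$ separates at least one point of $A$ from at least one point of $B$. A star is a maximal subset $S\subseteq\mathcal V_I$ with the property that $(A,B)=\emptyset$ for all $A,B\in S$; let $\mathcal W$ be the set of all stars. (If $\mathcal V_I=\emptyset$, the only star is the empty set.) Let $\mathcal T_M$ be the bipartite graph with vertex set $\mathcal V_I\sqcup\mathcal W$ in which $V\in\mathcal V_I$ and $W\in\mathcal W$ are joined by an edge if and only if $V\in W$. Then $\mathcal T_M$ is a simplicial tree (a nonempty connected graph without cycles). Moreover, for all $A,B\in\mathcal V_I$ the interval $(A,B)$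 is finite. -/

import Mathlib

namespace CutPairTree

variable {M : Type*} [TopologicalSpace M]

/-- `x` is a (global) cut point of the (connected) space `M`: its complement is disconnected.
The empty set counts as connected, so the point of a one-point space is not a cut point. -/
def IsCutPoint (x : M) : Prop :=
  ¬ IsPreconnected ({x}ᶜ : Set M)

/-- `S` separates `a` from `b`: both points lie outside `S`, in different components
of the complement of `S`. -/
def Separates (S : Set M) (a b : M) : Prop :=
  a ∉ S ∧ b ∉ S ∧ b ∉ connectedComponentIn Sᶜ a

/-- A cut pair: a set of two distinct points, neither of them a cut point,
whose complement is disconnected. -/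
def IsCutPair (C : Set M) : Prop :=
  ∃ x y : M, x ≠ y ∧ C = {x, y} ∧ ¬ IsCutPoint x ∧ ¬ IsCutPoint y ∧ ¬ IsPreconnected Cᶜ

/-- A cut pair is inseparable if its points are not separated by any other cut pair. -/
def IsInseparableCutPair (C : Set M) : Prop :=
  IsCutPair C ∧
    ∀ D : Set M, IsCutPair D → D ≠ C → ∀ x ∈ C, ∀ y ∈ C, ¬ Separates D x y

variable (M) in
/-- The type of all inseparable cut pairs of `M`. -/
def InsepCutPair : Type _ :=
  {C : Set M // IsInseparableCutPair C}

/-- `C` is between `A` and `B`: the set `C` separates at least one point of `A`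
from at least one point of `B`. -/
def Between (A C B : InsepCutPair M) : Prop :=
  ∃ a ∈ A.1, ∃ b ∈ B.1, Separates C.1 a b

/-- The open interval `(A, B)`: all inseparable cut pairs between `A` and `B`. -/
def openInterval (A B : InsepCutPair M) : Set (InsepCutPair M) :=
  {C | Between A C B}

/-- A star: a maximal set of inseparable cut pairs with all intervals between
its members empty. -/
def IsStar (S : Set (InsepCutPair M)) : Prop :=
  Maximal (fun T : Set (InsepCutPair M) => ∀ A ∈ T, ∀ B ∈ T, openInterval A B = ∅) S

variable (M) in
/-- The type of all stars of `M`. -/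
def StarVertex : Type _ :=
  {S : Set (InsepCutPair M) // IsStar S}

variable (M) in
/-- The bipartite graph on the disjoint union of the inseparable cut pairs and the stars,
a cut pair being joined to each star that contains it. -/
def cutPairGraph : SimpleGraph (InsepCutPair M ⊕ StarVertex M) where
  Adj
    | Sum.inl V, Sum.inr W => V ∈ W.1
    | Sum.inr W, Sum.inl V => V ∈ W.1
    | _, _ => False
  symm := ⟨by rintro (V | W) (V' | W') h <;> exact h⟩
  loopless := ⟨by rintro (V | W) h <;> exact h⟩

end CutPairTree

namespace CutPairTree

open Set Filter Topology

/-! ### Components of the complement of a cut pair -/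

section Separation

variable {M : Type*} [TopologicalSpace M]

/-! Betweenness on inseparable cut pairs satisfies the pretree axioms (`Between.symm`,
`not_between_self`, `Between.asymm`, `Between.left_or_right`); with finite intervals these alone
yield the tree. A pair strictly between `A` and `B` splits their interval into two smaller ones, so
induction connects any two pairs through stars. Deleting the edge from `V` to `W` disconnects its
ends, because `starSide` is crossed by no other edge; hence there are no cycles.

Finiteness is the topological part. If infinitely many pairs separate `a` from `b`, the components
containing `a` are nested (`component_subset_or_subset`), so a subsequence is monotone and, by
compactness, its pairs converge. If both limit points agree, that point is a cut point. Otherwise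
the regions between late pairs split into a part near each limit, and points of two such pairs
separate the pair between them, contradicting inseparability (`not_exists_monotone_of_tendsto`). -/

theorem Separates.symm {S : Set M} {a b : M} (h : Separates S a b) : Separates S b a := by
  refine ⟨h.2.1, h.1, fun hab => h.2.2 ?_⟩
  rw [← connectedComponentIn_eq hab]
  exact mem_connectedComponentIn h.2.1

theorem mem_component_of_not_separates {S : Set M} {a b : M} (ha : a ∉ S) (hb : b ∉ S)
    (h : ¬ Separates S a b) : b ∈ connectedComponentIn Sᶜ a := by
  by_contra hab
  exact h ⟨ha, hb, hab⟩

theorem disjoint_component (S : Set M) (a : M) : Disjoint (connectedComponentIn Sᶜ a) S :=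
  disjoint_left.2 fun _ hx => connectedComponentIn_subset _ _ hx

/-- A connected set that misses `S` lies on one side of `S`. -/
theorem not_separates_of_isPreconnected {S T : Set M} {a b : M} (hT : IsPreconnected T)
    (hTS : Disjoint T S) (ha : a ∈ T) (hb : b ∈ T) : ¬ Separates S a b :=
  fun h => h.2.2 (hT.subset_connectedComponentIn ha hTS.subset_compl_right hb)

theorem IsCutPair.finite {C : Set M} (hC : IsCutPair C) : C.Finite := by
  obtain ⟨x, y, -, rfl, -⟩ := hC
  exact toFinite _

theorem IsCutPair.ncard {C : Set M} (hC : IsCutPair C) : C.ncard = 2 := by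
  obtain ⟨x, y, hxy, rfl, -⟩ := hC
  exact ncard_pair hxy

theorem IsCutPair.exists_mem_notMem {C D : Set M} (hC : IsCutPair C) (hD : IsCutPair D)
    (h : D ≠ C) : ∃ d ∈ D, d ∉ C := by
  by_contra! hDC
  exact h (eq_of_subset_of_ncard_le hDC (by rw [hC.ncard, hD.ncard]) hC.finite)

theorem IsInseparableCutPair.mem_component {C D : Set M} (hC : IsInseparableCutPair C)
    (hD : IsCutPair D) {x y : M} (hx : x ∈ C) (hy : y ∈ C) (hxD : x ∉ D) (hyD : y ∉ D) :
    y ∈ connectedComponentIn Dᶜ x :=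
  mem_component_of_not_separates hxD hyD
    (hC.2 D hD (fun h => hxD (h ▸ hx)) x hx y hy)

section T1

variable [T1Space M] [LocallyConnectedSpace M]

theorem IsCutPair.isOpen_component {C : Set M} (hC : IsCutPair C) (a : M) :
    IsOpen (connectedComponentIn Cᶜ a) :=
  hC.finite.isClosed.isOpen_compl.connectedComponentIn

theorem IsCutPair.isClosed_component_union {C : Set M} (hC : IsCutPair C) (a : M) :
    IsClosed (connectedComponentIn Cᶜ a ∪ C) := by
  rw [← isOpen_compl_iff, isOpen_iff_forall_mem_open]
  intro z hz
  have hzC : z ∉ C := fun h => hz (Or.inr h)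
  refine ⟨connectedComponentIn Cᶜ z, fun w hw hw' => ?_, hC.isOpen_component z,
    mem_connectedComponentIn hzC⟩
  rcases hw' with hw' | hw'
  · refine hz (Or.inl ?_)
    rw [connectedComponentIn_eq hw', ← connectedComponentIn_eq hw]
    exact mem_connectedComponentIn hzC
  · exact absurd hw' (connectedComponentIn_subset _ _ hw)

/-- If `x` and `y` are not cut points, every component of the complement of `{x, y}`
accumulates at both of them. -/
theorem IsCutPair.subset_closure_component {C : Set M} (hC : IsCutPair C) {a : M} (ha : a ∉ C) :
    C ⊆ closure (connectedComponentIn Cᶜ a) := by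
  have key : ∀ x y : M, x ≠ y → C = {x, y} → ¬ IsCutPoint y →
      x ∈ closure (connectedComponentIn Cᶜ a) := by
    intro x y hxy hxC hy
    by_contra hx
    have hconn : IsPreconnected ({y}ᶜ : Set M) := not_not.1 hy
    have hay : a ∈ ({y}ᶜ : Set M) := fun h => ha (hxC ▸ Or.inr h)
    -- If `x` were not in the closure, the component would be clopen in the connected set `{y}ᶜ`,
    -- yet it misses `x`.
    have hsub := hconn.subset_left_of_subset_union (hC.isOpen_component a)
      (isClosed_closure (s := connectedComponentIn Cᶜ a)).isOpen_compl
      (disjoint_compl_right.mono_left subset_closure) ?_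
      ⟨a, hay, mem_connectedComponentIn ha⟩
    · exact hx (subset_closure (hsub hxy))
    · intro w hw
      by_cases hwc : w ∈ closure (connectedComponentIn Cᶜ a)
      · rcases closure_minimal subset_union_left (hC.isClosed_component_union a) hwc with h | h
        · exact Or.inl h
        · rw [hxC] at h
          rcases h with rfl | h
          · exact absurd hwc hx
          · exact absurd h hw
      · exact Or.inr hwc
  obtain ⟨x, y, hxy, hCxy, hx, hy, -⟩ := hC
  intro w hw
  rw [hCxy] at hw
  rcases hw with rfl | rfl
  · exact key _ y hxy hCxy hy
  · exact key _ x hxy.symm (by rw [hCxy, pair_comm]) hx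

theorem IsCutPair.closure_component {C : Set M} (hC : IsCutPair C) {a : M} (ha : a ∉ C) :
    closure (connectedComponentIn Cᶜ a) = connectedComponentIn Cᶜ a ∪ C :=
  (closure_minimal subset_union_left (hC.isClosed_component_union a)).antisymm
    (union_subset subset_closure (hC.subset_closure_component ha))

end T1

end Separation

/-! ### The pretree axioms for betweenness -/

section Betweenness

variable {M : Type*} [TopologicalSpace M]

theorem Between.symm {A C B : InsepCutPair M} (h : Between A C B) : Between B C A := by
  obtain ⟨a, ha, b, hb, hab⟩ := h
  exact ⟨b, hb, a, ha, hab.symm⟩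

theorem between_comm {A C B : InsepCutPair M} : Between A C B ↔ Between B C A :=
  ⟨Between.symm, Between.symm⟩

theorem Between.ne_left {A C B : InsepCutPair M} (h : Between A C B) : C ≠ A := by
  rintro rfl
  obtain ⟨a, ha, b, hb, hab⟩ := h
  exact hab.1 ha

theorem Between.ne_right {A C B : InsepCutPair M} (h : Between A C B) : C ≠ B :=
  h.symm.ne_left

theorem not_between_self (A C : InsepCutPair M) : ¬ Between A C A := by
  rintro ⟨a, ha, b, hb, hab⟩
  exact hab.2.2 (A.2.mem_component C.2.1 ha hb hab.1 hab.2.1)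

/-- Some point of `D` lies off `C`, and it cannot share a component of the complement with both `a`
and `b`. -/
theorem Between.left_or_right {A C B : InsepCutPair M} (h : Between A C B)
    {D : InsepCutPair M} (hD : D ≠ C) : Between A C D ∨ Between D C B := by
  obtain ⟨a, ha, b, hb, hab⟩ := h
  obtain ⟨d, hd, hdC⟩ := C.2.1.exists_mem_notMem D.2.1 (fun h => hD (Subtype.ext h))
  by_cases had : Separates C.1 a d
  · exact Or.inl ⟨a, ha, d, hd, had⟩
  · refine Or.inr ⟨d, hd, b, hb, hdC, hab.2.1, ?_⟩
    rw [← connectedComponentIn_eq (mem_component_of_not_separates hab.1 hdC had)]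
    exact hab.2.2

/-- By inseparability, all of `B` outside `C` lies in the component of `b`. -/
theorem disjoint_component_of_separates {C : Set M} (hC : IsCutPair C) {B : Set M}
    (hB : IsInseparableCutPair B) {a b : M} (hb : b ∈ B) (h : Separates C a b) :
    Disjoint (connectedComponentIn Cᶜ a) B := by
  refine disjoint_left.2 fun w hw hwB => h.2.2 ?_
  rw [connectedComponentIn_eq hw]
  exact hB.mem_component hC hwB hb (connectedComponentIn_subset _ _ hw) h.2.1

/-- The component of `a` off `C` misses `B` and accumulates at every point of `C`. Adding `c` keeps
it connected, so it joins `a'` to `c` off `B`. -/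
theorem Between.asymm [T1Space M] [LocallyConnectedSpace M] {A C B : InsepCutPair M}
    (h : Between A C B) : ¬ Between A B C := by
  rintro ⟨a', ha', c, hc, hac⟩
  obtain ⟨a, ha, b, hb, hab⟩ := h
  have ha'C : a' ∉ C.1 := fun h' =>
    hac.2.2 (C.2.mem_component B.2.1 h' hc hac.1 hac.2.1)
  have ha'U : a' ∈ connectedComponentIn C.1ᶜ a := A.2.mem_component C.2.1 ha ha' hab.1 ha'C
  have hdisj := disjoint_component_of_separates C.2.1 B.2 hb hab
  refine not_separates_of_isPreconnected
    (T := insert c (connectedComponentIn C.1ᶜ a)) ?_ ?_ (Or.inr ha'U) (Or.inl rfl) hac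
  · exact isPreconnected_connectedComponentIn.subset_closure (subset_insert _ _)
      (insert_subset (C.2.1.subset_closure_component hab.1 hc) subset_closure)
  · exact disjoint_insert_left.2 ⟨hac.2.1, hdisj⟩

theorem openInterval_ssubset [T1Space M] [LocallyConnectedSpace M] {A C B : InsepCutPair M}
    (h : Between A C B) : openInterval A C ⊂ openInterval A B := by
  refine (ssubset_iff_of_subset ?_).2 ⟨C, h, fun h' => h'.ne_right rfl⟩
  intro D (hD : Between A D C)
  have hDB : D ≠ B := by
    rintro rfl
    exact h.asymm hD
  refine (hD.left_or_right hDB.symm).resolve_right fun hBDC => ?_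
  rcases h.left_or_right hD.ne_right with h1 | h1
  · exact hD.asymm h1
  · exact hBDC.asymm h1.symm

end Betweenness

/-! ### Finiteness of intervals -/

section FiniteIntervals

theorem exists_subseq_injective_or {α : Type*} {x y : ℕ → α}
    (h : Function.Injective fun i => (x i, y i)) :
    ∃ g : ℕ ↪o ℕ, Function.Injective (x ∘ g) ∨ Function.Injective (y ∘ g) := by
  obtain ⟨g, hg | hg⟩ := exists_increasing_or_nonincreasing_subseq (· = ·) x
  · refine ⟨g, Or.inr fun m n hmn => g.injective (h (Prod.ext ?_ hmn))⟩
    rcases lt_trichotomy m n with h' | rfl | h'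
    · exact hg m n h'
    · rfl
    · exact (hg n m h').symm
  · refine ⟨g, Or.inl fun m n hmn => ?_⟩
    rcases lt_trichotomy m n with h' | rfl | h'
    · exact absurd hmn (hg m n h')
    · rfl
    · exact absurd hmn.symm (hg n m h')

variable {M : Type*} [TopologicalSpace M]

/-- Away from the limit points of the pairs `{x i, y i}`, an increasing sequence of open sets
bounded by these pairs is locally eventually constant. -/
theorem exists_nhds_subset_or_disjoint [LocallyConnectedSpace M] [T3Space M]
    {x y : ℕ → M} {x₀ y₀ z : M} {U : ℕ → Set M}
    (hx : Tendsto x atTop (𝓝 x₀)) (hy : Tendsto y atTop (𝓝 y₀))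
    (hopen : ∀ i, IsOpen (U i)) (hclosed : ∀ i, IsClosed (U i ∪ {x i, y i}))
    (hmono : Monotone U) (hzx : z ≠ x₀) (hzy : z ≠ y₀) :
    ∃ O : Set M, IsOpen O ∧ z ∈ O ∧ ((∃ N, ∀ i, N ≤ i → O ⊆ U i) ∨ ∀ i, Disjoint O (U i)) := by
  have hz : ({x₀, y₀}ᶜ : Set M) ∈ 𝓝 z :=
    (toFinite _).isClosed.isOpen_compl.mem_nhds (by simp [hzx, hzy])
  obtain ⟨F, hF, hFc, hFs⟩ := exists_mem_nhds_isClosed_subset hz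
  obtain ⟨O, hOF, hO, hzO, hOc⟩ :=
    locallyConnectedSpace_iff_subsets_isOpen_isConnected.1 ‹_› z F hF
  have hFx : Fᶜ ∈ 𝓝 x₀ := hFc.isOpen_compl.mem_nhds fun h => hFs h (Or.inl rfl)
  have hFy : Fᶜ ∈ 𝓝 y₀ := hFc.isOpen_compl.mem_nhds fun h => hFs h (Or.inr rfl)
  obtain ⟨N, hN⟩ := eventually_atTop.1 ((hx.eventually_mem hFx).and (hy.eventually_mem hFy))
  refine ⟨O, hO, hzO, or_iff_not_imp_right.2 fun hdis => ?_⟩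
  push Not at hdis
  obtain ⟨j, hj⟩ := hdis
  obtain ⟨w, hwO, hwj⟩ := not_disjoint_iff.1 hj
  -- From `N` on the boundary pairs avoid the connected set `O`; from `j` on `U i` meets it, so `U
  -- i` must contain it.
  refine ⟨max N j, fun i hi => ?_⟩
  have hNi := hN i ((le_max_left _ _).trans hi)
  refine hOc.isPreconnected.subset_left_of_subset_union (hopen i) (hclosed i).isOpen_compl
    (disjoint_compl_right.mono_left subset_union_left) (fun v hv => ?_)
    ⟨w, hwO, hmono ((le_max_right _ _).trans hi) hwj⟩
  by_cases hvU : v ∈ U i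
  · exact Or.inl hvU
  · refine Or.inr ?_
    rintro (h | rfl | h)
    · exact hvU h
    · exact hNi.1 (hOF hv)
    · rw [mem_singleton_iff] at h
      subst h
      exact hNi.2 (hOF hv)

theorem not_exists_monotone_of_tendsto [LocallyConnectedSpace M] [CompactSpace M] [T2Space M]
    (hM : ∀ x : M, ¬ IsCutPoint x)
    {x y : ℕ → M} {x₀ y₀ : M} {U : ℕ → Set M}
    (hx : Tendsto x atTop (𝓝 x₀)) (hy : Tendsto y atTop (𝓝 y₀))
    (hinj : Function.Injective x) (hinsep : ∀ i, IsInseparableCutPair {x i, y i})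
    (hopen : ∀ i, IsOpen (U i)) (hclosed : ∀ i, IsClosed (U i ∪ {x i, y i}))
    (hdisj : ∀ i, Disjoint (U i) {x i, y i}) (hmono : Monotone U)
    (hsub : ∀ i j, i < j → {x i, y i} ⊆ U j ∪ {x j, y j})
    {p q : M} (hpq : p ≠ q) (hp : ∀ i, p ∉ U i) (hq : ∀ i, q ∉ U i) : False := by
  have hloc := fun z => exists_nhds_subset_or_disjoint (z := z) hx hy hopen hclosed hmono
  by_cases hxy : x₀ = y₀
  · subst hxy
    -- With a single limit point, `⋃ i, U i` is clopen in `{x₀}ᶜ`; it is nonempty there but omits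
    -- `p` or `q`.
    have hcover : ({x₀}ᶜ : Set M) ⊆ (⋃ i, U i) ∪ interior (⋃ i, U i)ᶜ := by
      intro z hz
      obtain ⟨O, hO, hzO, ⟨N, hN⟩ | h⟩ := hloc z hz hz
      · exact Or.inl (mem_iUnion.2 ⟨N, hN N le_rfl hzO⟩)
      · refine Or.inr (mem_interior.2 ⟨O, fun w hw hw' => ?_, hO, hzO⟩)
        obtain ⟨i, hi⟩ := mem_iUnion.1 hw'
        exact disjoint_left.1 (h i) hw hi
    have hmeet : (({x₀}ᶜ : Set M) ∩ ⋃ i, U i).Nonempty := by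
      obtain ⟨i, hi⟩ : ∃ i, x i ≠ x₀ := by
        by_contra! h
        exact zero_ne_one (hinj ((h 0).trans (h 1).symm))
      obtain ⟨j, ⟨hxj, hyj⟩, hij⟩ := ((hx.eventually_ne hi.symm).and
        (hy.eventually_ne hi.symm)).and (eventually_gt_atTop i) |>.exists
      refine ⟨x i, hi, mem_iUnion.2 ⟨j, ?_⟩⟩
      refine (hsub i j hij (Or.inl rfl)).resolve_right ?_
      rintro (h | h)
      · exact hxj h.symm
      · exact hyj h.symm
    have hle := (not_not.1 (hM x₀)).subset_left_of_subset_union (isOpen_iUnion hopen)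
      isOpen_interior (disjoint_compl_right.mono_right interior_subset) hcover hmeet
    by_cases hpx : p = x₀
    · obtain ⟨i, hi⟩ := mem_iUnion.1 (hle (show q ∈ ({x₀}ᶜ : Set M) from hpx ▸ hpq.symm))
      exact hq i hi
    · obtain ⟨i, hi⟩ := mem_iUnion.1 (hle hpx)
      exact hp i hi
  · obtain ⟨P, Q, hP, hQ, hxP, hyQ, hPQ⟩ := t2_separation hxy
    -- By compactness, the sets `U i` stop growing outside `P ∪ Q` after finitely many steps.
    have hstable : ∃ N, ∀ i, N ≤ i → ∀ w ∈ (P ∪ Q)ᶜ, w ∈ U i → w ∈ U N := by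
      refine (hP.union hQ).isClosed_compl.isCompact.induction_on
        (p := fun s => ∃ N, ∀ i, N ≤ i → ∀ w ∈ s, w ∈ U i → w ∈ U N) ⟨0, by simp⟩ ?_ ?_ ?_
      · rintro s t hst ⟨N, hN⟩
        exact ⟨N, fun i hi w hw => hN i hi w (hst hw)⟩
      · rintro s t ⟨N, hN⟩ ⟨N', hN'⟩
        refine ⟨max N N', fun i hi w hw hwi => ?_⟩
        rcases hw with hw | hw
        · exact hmono (le_max_left _ _) (hN i ((le_max_left _ _).trans hi) w hw hwi)
        · exact hmono (le_max_right _ _) (hN' i ((le_max_right _ _).trans hi) w hw hwi)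
      · intro z hz
        obtain ⟨O, hO, hzO, h⟩ := hloc z (by rintro rfl; exact hz (Or.inl hxP))
          (by rintro rfl; exact hz (Or.inr hyQ))
        refine ⟨O, mem_nhdsWithin_of_mem_nhds (hO.mem_nhds hzO), ?_⟩
        rcases h with ⟨N, hN⟩ | h
        · exact ⟨N, fun i _ w hw _ => hN N le_rfl hw⟩
        · exact ⟨0, fun i _ w hw hwi => absurd hwi (disjoint_left.1 (h i) hw)⟩
    obtain ⟨N, hN⟩ := hstable
    obtain ⟨i, hi, hiPQ⟩ : ∃ i, N ≤ i ∧ ∀ j, i ≤ j → x j ∈ P ∧ y j ∈ Q := by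
      obtain ⟨N', hN'⟩ := eventually_atTop.1
        ((hx.eventually_mem (hP.mem_nhds hxP)).and (hy.eventually_mem (hQ.mem_nhds hyQ)))
      exact ⟨max N N', le_max_left _ _, fun j hj => hN' j ((le_max_right _ _).trans hj)⟩
    obtain ⟨hxi, hyi⟩ := hiPQ i le_rfl
    obtain ⟨hxj, hyj⟩ := hiPQ (i + 1) (by omega)
    obtain ⟨hxk, hyk⟩ := hiPQ (i + 2) (by omega)
    have hji : x (i + 1) ≠ x i := hinj.ne (by omega)
    have hjk : x (i + 1) ≠ x (i + 2) := hinj.ne (by omega)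
    have hne : ∀ {u v : M}, u ∈ P → v ∈ Q → u ≠ v := fun hu hv h =>
      disjoint_left.1 hPQ hu (h ▸ hv)
    have hxjD : x (i + 1) ∈ ({x i, x (i + 2)} : Set M)ᶜ := by simp [hji, hjk]
    have hyjD : y (i + 1) ∈ ({x i, x (i + 2)} : Set M)ᶜ := by
      simp [(hne hxi hyj).symm, (hne hxk hyj).symm]
    -- The part in `P` of the region between pairs `i` and `i + 2` has only `x i` and `x (i + 2)` as
    -- possible boundary points, since beyond `N` the region lies in `P ∪ Q`. It contains `x (i +
    -- 1)` but not `y (i + 1)`.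
    have hsep : ∀ T : Set M, IsPreconnected T → T ⊆ ({x i, x (i + 2)} : Set M)ᶜ →
        x (i + 1) ∈ T → y (i + 1) ∉ T := by
      intro T hT hTD hxT hyT
      have hle := hT.subset_left_of_subset_union
        (u := P ∩ (U (i + 2) \ (U i ∪ {x i, y i})))
        (v := Q ∪ U i ∪ (U (i + 2) ∪ {x (i + 2), y (i + 2)})ᶜ)
        (hP.inter ((hopen _).sdiff (hclosed i)))
        ((hQ.union (hopen i)).union (hclosed (i + 2)).isOpen_compl) ?_ ?_ ?_
      · exact hne (hle hyT).1 hyj rfl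
      · refine disjoint_left.2 ?_
        rintro w ⟨hwP, hwk, hwi⟩ ((hw | hw) | hw)
        · exact hne hwP hw rfl
        · exact hwi (Or.inl hw)
        · exact hw (Or.inl hwk)
      · intro w hw
        by_contra hwS
        have hwD := hTD hw
        simp only [mem_union, mem_inter_iff, Set.mem_sdiff, mem_compl_iff, mem_insert_iff,
          mem_singleton_iff, not_or] at hwS hwD
        obtain ⟨hwS, ⟨hwQ, hwi⟩, hwk⟩ := hwS
        have hwk' : w ∈ U (i + 2) := by
          by_contra h
          exact hwk ⟨h, hwD.2, fun h' => hwQ (h' ▸ hyk)⟩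
        have hwP : w ∈ P := by
          by_contra hwP
          refine hwi (hmono hi (hN (i + 2) (by omega) w ?_ hwk'))
          rintro (h | h)
          · exact hwP h
          · exact hwQ h
        exact hwS ⟨hwP, hwk', hwi, hwD.1, fun h => hwQ (h ▸ hyi)⟩
      · refine ⟨x (i + 1), hxT, hxj, ?_, ?_⟩
        · refine (hsub (i + 1) (i + 2) (by omega) (Or.inl rfl)).resolve_right ?_
          rintro (h | h)
          · exact hjk h
          · exact hne hxj hyk h
        · rintro (h | h | h)
          · exact disjoint_left.1 (hdisj (i + 1)) (hmono (by omega) h) (Or.inl rfl)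
          · exact hji h
          · exact hne hxj hyi h
    refine (hinsep (i + 1)).2 {x i, x (i + 2)}
      ⟨_, _, hinj.ne (by omega), rfl, hM _, hM _, fun h => hsep _ h subset_rfl hxjD hyjD⟩
      (fun h => hxjD (h ▸ Or.inl rfl)) (x (i + 1)) (Or.inl rfl) (y (i + 1)) (Or.inr rfl)
      ⟨hxjD, hyjD, ?_⟩
    exact hsep _ isPreconnected_connectedComponentIn (connectedComponentIn_subset _ _)
      (mem_connectedComponentIn hxjD)

/-- There is no infinite increasing sequence of open sets bounded by distinct inseparable
cut pairs and omitting two points. -/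
theorem not_exists_monotone [LocallyConnectedSpace M] [CompactSpace M]
    [TopologicalSpace.MetrizableSpace M] (hM : ∀ x : M, ¬ IsCutPoint x)
    {C U : ℕ → Set M} (hinj : Function.Injective C) (hinsep : ∀ i, IsInseparableCutPair (C i))
    (hopen : ∀ i, IsOpen (U i)) (hclosed : ∀ i, IsClosed (U i ∪ C i))
    (hdisj : ∀ i, Disjoint (U i) (C i)) (hmono : Monotone U)
    (hsub : ∀ i j, i < j → C i ⊆ U j ∪ C j)
    {p q : M} (hpq : p ≠ q) (hp : ∀ i, p ∉ U i) (hq : ∀ i, q ∉ U i) : False := by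
  let _ := TopologicalSpace.metrizableSpaceMetric M
  have hpair : ∀ i, ∃ x y : M, C i = {x, y} := fun i => by
    obtain ⟨x, y, -, h, -⟩ := (hinsep i).1
    exact ⟨x, y, h⟩
  have core : ∀ (x y : ℕ → M) (g : ℕ ↪o ℕ), (∀ i, C i = {x i, y i}) →
      Function.Injective (x ∘ g) → False := by
    intro x y g hCxy hxg
    obtain ⟨⟨x₀, y₀⟩, φ, hφ, hlim⟩ :=
      CompactSpace.tendsto_subseq fun i => ((x ∘ g) i, (y ∘ g) i)
    have hgφ : StrictMono (g ∘ φ) := g.strictMono.comp hφ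
    simp only [hCxy] at hinsep hclosed hdisj hsub
    exact not_exists_monotone_of_tendsto hM (x := x ∘ g ∘ φ) (y := y ∘ g ∘ φ)
      (U := U ∘ g ∘ φ) ((continuous_fst.tendsto _).comp hlim)
      ((continuous_snd.tendsto _).comp hlim) (hxg.comp hφ.injective) (fun i => hinsep _)
      (fun i => hopen _) (fun i => hclosed _) (fun i => hdisj _) (hmono.comp hgφ.monotone)
      (fun i j hij => hsub _ _ (hgφ hij)) hpq (fun i => hp _) (fun i => hq _)
  choose x y hxy using hpair
  obtain ⟨g, hg | hg⟩ := exists_subseq_injective_or (x := x) (y := y) fun i j hij => hinj <| by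
    obtain ⟨h1, h2⟩ := Prod.ext_iff.1 hij
    simp only at h1 h2
    rw [hxy, hxy, h1, h2]
  · exact core x y g hxy hg
  · exact core y x g (fun i => by rw [hxy, pair_comm]) hg

/-- If each component of `a` meets the other pair, inseparability keeps each component of `b` off
the other pair. The two components of `b` then coincide, and so do their boundaries `C` and `D`. -/
theorem component_subset_or_subset [T1Space M] [LocallyConnectedSpace M] {C D : Set M}
    (hC : IsInseparableCutPair C) (hD : IsInseparableCutPair D) {a b : M}
    (hCab : Separates C a b) (hDab : Separates D a b) :
    connectedComponentIn Cᶜ a ⊆ connectedComponentIn Dᶜ a ∨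
      connectedComponentIn Dᶜ a ⊆ connectedComponentIn Cᶜ a := by
  have hle : ∀ {C D : Set M} {a : M}, a ∉ C → Disjoint (connectedComponentIn Cᶜ a) D →
      connectedComponentIn Cᶜ a ⊆ connectedComponentIn Dᶜ a := fun ha h =>
    isPreconnected_connectedComponentIn.subset_connectedComponentIn (mem_connectedComponentIn ha)
      h.subset_compl_right
  have hside : ∀ {C D : Set M}, IsInseparableCutPair C → IsInseparableCutPair D →
      Separates C a b → ¬ Disjoint (connectedComponentIn Cᶜ a) D →
      connectedComponentIn Cᶜ b ⊆ connectedComponentIn Dᶜ b := by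
    intro C D hC hD hab hdis
    refine hle hab.2.1 (disjoint_left.2 fun w hw hwD => hdis ?_)
    refine disjoint_component_of_separates hC.1 hD hwD
      ⟨hab.1, connectedComponentIn_subset _ _ hw, ?_⟩
    intro hw'
    refine hab.2.2 ?_
    rw [connectedComponentIn_eq hw', ← connectedComponentIn_eq hw]
    exact mem_connectedComponentIn hab.2.1
  by_cases h1 : Disjoint (connectedComponentIn Cᶜ a) D
  · exact Or.inl (hle hCab.1 h1)
  by_cases h2 : Disjoint (connectedComponentIn Dᶜ a) C
  · exact Or.inr (hle hDab.1 h2)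
  have heq := (hside hC hD hCab h1).antisymm (hside hD hC hDab h2)
  have hcl := hC.1.closure_component hCab.2.1
  rw [heq, hD.1.closure_component hDab.2.1] at hcl
  have hCD : C = D := by
    have hdC := disjoint_component C b
    have hdD := disjoint_component D b
    rw [heq] at hdC
    exact (hdC.symm.sdiff_eq_left.symm.trans (by
      rw [← union_sdiff_left, ← hcl, union_sdiff_left])).trans hdD.symm.sdiff_eq_left
  exact Or.inl (hCD ▸ subset_rfl)

theorem finite_openInterval [LocallyConnectedSpace M] [CompactSpace M]
    [TopologicalSpace.MetrizableSpace M] (hM : ∀ x : M, ¬ IsCutPoint x)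
    (A B : InsepCutPair M) : (openInterval A B).Finite := by
  let _ := TopologicalSpace.metrizableSpaceMetric M
  have hfix : ∀ a ∈ A.1, ∀ b ∈ B.1, {C : InsepCutPair M | Separates C.1 a b}.Finite := by
    intro a ha b hb
    by_contra hinf
    have hinf : {C : InsepCutPair M | Separates C.1 a b}.Infinite := hinf
    let f := hinf.natEmbedding
    obtain ⟨g, hg⟩ := exists_increasing_or_nonincreasing_subseq
      (fun S T : Set M => S ⊆ T) fun n => connectedComponentIn (f n).1.1ᶜ a
    let C : ℕ → InsepCutPair M := fun n => (f (g n)).1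
    have hC : ∀ n, Separates (C n).1 a b := fun n => (f (g n)).2
    have hinj : Function.Injective fun n => (C n).1 :=
      Subtype.val_injective.comp (Subtype.val_injective.comp (f.injective.comp g.injective))
    let U : ℕ → Set M := fun n => connectedComponentIn (C n).1ᶜ a
    have hcl : ∀ n, closure (U n) = U n ∪ (C n).1 := fun n =>
      (C n).2.1.closure_component (hC n).1
    have hopen : ∀ n, IsOpen (U n) := fun n => (C n).2.1.isOpen_component a
    have hclosed : ∀ n, IsClosed (U n ∪ (C n).1) := fun n =>
      (C n).2.1.isClosed_component_union a
    have hdisj : ∀ n, Disjoint (U n) (C n).1 := fun n => disjoint_component _ _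
    have two_points : ∀ D : InsepCutPair M, ∃ p ∈ D.1, ∃ q ∈ D.1, p ≠ q := fun D => by
      obtain ⟨p, q, hpq, hD, -⟩ := D.2.1
      exact ⟨p, by simp [hD], q, by simp [hD], hpq⟩
    rcases hg with hg | hg
    · obtain ⟨p, hp, q, hq, hpq⟩ := two_points B
      have hmono : Monotone U := monotone_nat_of_le_succ fun n => hg n (n + 1) (Nat.lt_succ_self n)
      have hB : ∀ n, Disjoint (U n) B.1 := fun n =>
        disjoint_component_of_separates (C n).2.1 B.2 hb (hC n)
      exact not_exists_monotone hM hinj (fun n => (C n).2) hopen hclosed hdisj hmono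
        (fun i j hij => (subset_union_right.trans (hcl i).ge).trans
          ((closure_mono (hmono hij.le)).trans (hcl j).le)) hpq
        (fun n h => disjoint_left.1 (hB n) h hp) (fun n h => disjoint_left.1 (hB n) h hq)
    · obtain ⟨p, hp, q, hq, hpq⟩ := two_points A
      have hanti : Antitone U := antitone_nat_of_succ_le fun n =>
        (component_subset_or_subset (C n).2 (C (n + 1)).2 (hC n) (hC (n + 1))).resolve_left
          (hg n (n + 1) (Nat.lt_succ_self n))
      have hcompl : ∀ n, (U n ∪ (C n).1)ᶜ ∪ (C n).1 = (U n)ᶜ := fun n => by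
        ext w
        have := fun h h' => Set.disjoint_left.1 (hdisj n) (show w ∈ U n from h) h'
        simp only [mem_union, mem_compl_iff]
        tauto
      have hA : ∀ n, ∀ w ∈ A.1, w ∉ (U n ∪ (C n).1)ᶜ := fun n w hw h =>
        h (or_iff_not_imp_right.2 fun hwC => A.2.mem_component (C n).2.1 ha hw (hC n).1 hwC)
      -- A decreasing sequence becomes increasing on passing to the complements of the closures,
      -- which omit the two points of `A`.
      refine not_exists_monotone hM hinj (fun n => (C n).2)
        (U := fun n => (U n ∪ (C n).1)ᶜ) (fun n => (hclosed n).isOpen_compl)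
        (fun n => ?_) (fun n => disjoint_compl_left.mono_right subset_union_right)
        (fun i j hij => ?_) (fun i j hij => ?_) hpq (fun n => hA n p hp) (fun n => hA n q hq)
      · rw [hcompl]
        exact (hopen n).isClosed_compl
      · refine compl_subset_compl.2 ?_
        rw [← hcl, ← hcl]
        exact closure_mono (hanti hij)
      · rw [hcompl]
        exact ((hdisj i).mono_left (hanti hij.le)).symm.subset_compl_right
  refine (A.2.1.finite.biUnion fun a ha => B.2.1.finite.biUnion fun b hb =>
    hfix a ha b hb).subset ?_
  rintro C ⟨a, ha, b, hb, h⟩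
  simp only [mem_iUnion]
  exact ⟨a, ha, b, hb, h⟩

end FiniteIntervals

/-! ### The bipartite graph is a tree -/

section Tree

variable {M : Type*} [TopologicalSpace M]

theorem openInterval_self (A : InsepCutPair M) : openInterval A A = ∅ :=
  eq_empty_of_forall_notMem fun C => not_between_self A C

theorem openInterval_comm (A B : InsepCutPair M) : openInterval A B = openInterval B A :=
  ext fun _ => between_comm

theorem exists_isStar_superset {S : Set (InsepCutPair M)}
    (hS : ∀ A ∈ S, ∀ B ∈ S, openInterval A B = ∅) : ∃ W : StarVertex M, S ⊆ W.1 := by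
  obtain ⟨W, hSW, hW⟩ := zorn_subset_nonempty
    {T : Set (InsepCutPair M) | ∀ A ∈ T, ∀ B ∈ T, openInterval A B = ∅} (fun c hc hchain _ => by
      refine ⟨⋃₀ c, ?_, fun s hs => subset_sUnion_of_mem hs⟩
      rintro A ⟨s, hs, hAs⟩ B ⟨t, ht, hBt⟩
      rcases hchain.total hs ht with h | h
      · exact hc ht A (h hAs) B hBt
      · exact hc hs A hAs B (h hBt)) S hS
  exact ⟨⟨W, hW⟩, hSW⟩

theorem exists_isStar_of_openInterval_eq_empty {A B : InsepCutPair M}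
    (h : openInterval A B = ∅) : ∃ W : StarVertex M, A ∈ W.1 ∧ B ∈ W.1 := by
  obtain ⟨W, hW⟩ := exists_isStar_superset (S := {A, B}) (by
    rintro X (rfl | rfl) Y (rfl | rfl)
    · exact openInterval_self _
    · exact h
    · rw [openInterval_comm]; exact h
    · exact openInterval_self _)
  exact ⟨W, hW (Or.inl rfl), hW (Or.inr rfl)⟩

theorem StarVertex.not_between (W : StarVertex M) {A B : InsepCutPair M} (hA : A ∈ W.1)
    (hB : B ∈ W.1) (C : InsepCutPair M) : ¬ Between A C B := fun h =>
  (W.2.prop A hA B hB).le h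

theorem StarVertex.nonempty [Nonempty (InsepCutPair M)] (W : StarVertex M) : W.1.Nonempty := by
  obtain ⟨A⟩ := ‹Nonempty (InsepCutPair M)›
  by_contra hW
  rw [not_nonempty_iff_eq_empty] at hW
  have h := W.2.2 (y := {A}) (by
    rintro X rfl Y rfl
    exact openInterval_self _) (by rw [hW]; exact empty_subset _) rfl
  rw [hW] at h
  exact h

theorem reachable_of_mem {W : StarVertex M} {A : InsepCutPair M} (h : A ∈ W.1) :
    (cutPairGraph M).Reachable (Sum.inl A) (Sum.inr W) :=
  SimpleGraph.Adj.reachable (G := cutPairGraph M) h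

theorem reachable_inl [T1Space M] [LocallyConnectedSpace M]
    (hfin : ∀ A B : InsepCutPair M, (openInterval A B).Finite) (A B : InsepCutPair M) :
    (cutPairGraph M).Reachable (Sum.inl A) (Sum.inl B) := by
  induction hn : (openInterval A B).ncard using Nat.strong_induction_on generalizing A B with
  | _ n ih =>
    rcases (openInterval A B).eq_empty_or_nonempty with h | ⟨C, hC⟩
    · obtain ⟨W, hA, hB⟩ := exists_isStar_of_openInterval_eq_empty h
      exact (reachable_of_mem hA).trans (reachable_of_mem hB).symm
    · have h1 := ncard_lt_ncard (openInterval_ssubset hC) (hfin A B)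
      have h2 := ncard_lt_ncard (openInterval_ssubset hC.symm) (hfin B A)
      rw [openInterval_comm B C, openInterval_comm B A] at h2
      exact (ih _ (hn ▸ h1) A C rfl).trans (ih _ (hn ▸ h2) C B rfl)

theorem cutPairGraph_connected [T1Space M] [LocallyConnectedSpace M]
    (hfin : ∀ A B : InsepCutPair M, (openInterval A B).Finite) :
    (cutPairGraph M).Connected := by
  -- Extending the empty set provides a vertex even when there are no inseparable cut pairs.
  obtain ⟨W₀, -⟩ := exists_isStar_superset (M := M) (S := ∅) (by simp)
  have : Nonempty (InsepCutPair M ⊕ StarVertex M) := ⟨Sum.inr W₀⟩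
  refine SimpleGraph.Connected.mk ?_
  rcases isEmpty_or_nonempty (InsepCutPair M) with hV | hV
  · rintro (A | W) (B | W')
    · exact hV.elim A
    · exact hV.elim A
    · exact hV.elim B
    · rw [show W = W' from Subtype.ext (Subsingleton.elim _ _)]
  · have hstar : ∀ v, ∃ A : InsepCutPair M, (cutPairGraph M).Reachable v (Sum.inl A) := by
      rintro (A | W)
      · exact ⟨A, SimpleGraph.Reachable.refl _⟩
      · obtain ⟨A, hA⟩ := W.nonempty
        exact ⟨A, (reachable_of_mem hA).symm⟩
    intro v w
    obtain ⟨A, hA⟩ := hstar v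
    obtain ⟨B, hB⟩ := hstar w
    exact hA.trans ((reachable_inl hfin A B).trans hB.symm)

/-- Two stars at `V` that are not separated by `V` coincide. -/
theorem StarVertex.eq_of_not_between {W W' : StarVertex M} {V X Y : InsepCutPair M}
    (hV : V ∈ W.1) (hV' : V ∈ W'.1) (hX : X ∈ W.1) (hY : Y ∈ W'.1) (hXV : X ≠ V) (hYV : Y ≠ V)
    (h : ¬ Between X V Y) : W = W' := by
  have hcross : ∀ A ∈ W.1, ∀ B ∈ W'.1, openInterval A B = ∅ := by
    refine fun A hA B hB => eq_empty_of_forall_notMem fun D (hD : Between A D B) => ?_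
    -- If `D = V`, moving from `A` to `X` and from `B` to `Y` within the stars would put `V` between
    -- `X` and `Y`.
    by_cases hDV : D = V
    · subst hDV
      rcases hD.left_or_right hXV with h1 | h1
      · exact W.not_between hA hX _ h1
      rcases h1.left_or_right hYV with h2 | h2
      · exact h h2
      · exact W'.not_between hY hB _ h2
    · rcases hD.left_or_right (Ne.symm hDV) with h1 | h1
      · exact W.not_between hA hV _ h1
      · exact W'.not_between hV' hB _ h1
  have hclique : ∀ A ∈ W.1 ∪ W'.1, ∀ B ∈ W.1 ∪ W'.1, openInterval A B = ∅ := by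
    rintro A (hA | hA) B (hB | hB)
    · exact W.2.prop A hA B hB
    · exact hcross A hA B hB
    · rw [openInterval_comm]; exact hcross B hB A hA
    · exact W'.2.prop A hA B hB
  exact Subtype.ext ((W.2.eq_of_subset hclique subset_union_left).trans
    (W'.2.eq_of_subset hclique subset_union_right).symm)

/-- The vertices of the graph on the same side of the edge from `V` to `W` as `W`. -/
def starSide (V : InsepCutPair M) (W : StarVertex M) : Set (InsepCutPair M ⊕ StarVertex M) :=
  let S : Set (InsepCutPair M) := {A | A ≠ V ∧ ∃ X ∈ W.1, X ≠ V ∧ ¬ Between A V X}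
  {v | Sum.elim (· ∈ S) (fun W' => W' = W ∨ ∃ A ∈ W'.1, A ∈ S) v}

/-- Members of one star are never separated by `V`, so those other than `V` are on the same side. If
`A = V`, a member of `W'` on the side of `W` forces `W' = W`. -/
theorem inl_mem_starSide_iff {V A : InsepCutPair M} {W W' : StarVertex M} (hV : V ∈ W.1)
    (hA : A ∈ W'.1) (hne : ¬ (A = V ∧ W' = W)) :
    Sum.inl A ∈ starSide V W ↔ Sum.inr W' ∈ starSide V W := by
  constructor
  · exact fun h => Or.inr ⟨A, hA, h⟩
  · rintro (rfl | ⟨Y, hY, hYV, X, hX, hXV, hYX⟩)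
    · have hAV : A ≠ V := fun h => hne ⟨h, rfl⟩
      exact ⟨hAV, A, hA, hAV, not_between_self A V⟩
    · have hAV : A ≠ V := by
        rintro rfl
        exact hne ⟨rfl, StarVertex.eq_of_not_between hA hV hY hX hYV hXV hYX⟩
      refine ⟨hAV, X, hX, hXV, fun h => ?_⟩
      rcases h.left_or_right hYV with h1 | h1
      · exact W'.not_between hA hY _ h1
      · exact hYX h1

theorem cutPairGraph_isBridge {V : InsepCutPair M} {W : StarVertex M} (hV : V ∈ W.1) :
    (cutPairGraph M).IsBridge s(Sum.inl V, Sum.inr W) := by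
  rw [SimpleGraph.isBridge_iff]
  rintro ⟨p⟩
  have hstep : ∀ v w, ((cutPairGraph M).deleteEdges {s(Sum.inl V, Sum.inr W)}).Adj v w →
      (v ∈ starSide V W ↔ w ∈ starSide V W) := by
    intro v w h
    rw [SimpleGraph.deleteEdges_adj] at h
    obtain ⟨hadj, hne⟩ := h
    rcases v with A | W₁ <;> rcases w with B | W₂
    · exact hadj.elim
    · refine inl_mem_starSide_iff hV hadj ?_
      rintro ⟨rfl, rfl⟩
      exact hne rfl
    · refine (inl_mem_starSide_iff hV hadj ?_).symm
      rintro ⟨rfl, rfl⟩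
      exact hne Sym2.eq_swap
    · exact hadj.elim
  have hwalk : ∀ {v w} (_ : ((cutPairGraph M).deleteEdges {s(Sum.inl V, Sum.inr W)}).Walk v w),
      (v ∈ starSide V W ↔ w ∈ starSide V W) := by
    intro v w q
    induction q with
    | nil => rfl
    | cons h _ ih => exact (hstep _ _ h).trans ih
  exact ((hwalk p).2 (Or.inl rfl)).1 rfl

theorem cutPairGraph_isAcyclic : (cutPairGraph M).IsAcyclic := by
  rw [SimpleGraph.isAcyclic_iff_forall_adj_isBridge]
  rintro (A | W) (B | W') h
  · exact h.elim
  · exact cutPairGraph_isBridge h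
  · rw [Sym2.eq_swap]
    exact cutPairGraph_isBridge h
  · exact h.elim

end Tree

end CutPairTree

theorem mainTheorem6 {M : Type*} [TopologicalSpace M] [CompactSpace M] [ConnectedSpace M]
    [LocallyConnectedSpace M] [TopologicalSpace.MetrizableSpace M]
    (hM : ∀ x : M, ¬ CutPairTree.IsCutPoint x) :
    (CutPairTree.cutPairGraph M).IsTree ∧
      ∀ A B : CutPairTree.InsepCutPair M, (CutPairTree.openInterval A B).Finite := by
  have hfin := CutPairTree.finite_openInterval hM
  exact ⟨⟨CutPairTree.cutPairGraph_connected hfin, CutPairTree.cutPairGraph_isAcyclic⟩, hfin⟩
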